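/- Let $k,n\ge 0$ be integers and let $FA=\mathbb F_2\langle a_1,\dots,a_k\rangle$ be the free associative algebra over the field with two elements, graded by the length of monomials. A *homogeneous monomial system* over $FA$ in the unknowns $x_1,\dots,x_n$ is a finite system of equations $u_i=v_i$, $1\le i\le s$, where each $u_i$ and $v_i$ is a word in the free semigroup generated by the unknowns $x_1,\dots,x_n$ and finitely many coefficients $c_1,\dots,c_\ell\in FA$, and where all the coefficients are homogeneous elements of $FA$ (not necessarily monomials). A *homogeneous solution* of such a system is a solution $(x_1^0,\dots,x_n^0)\in FA^n$ all of whose entries are homogeneous elements of $FA$, possibly of different degrees; here $0$ counts as homogeneous. Then the collection of the sets of homogeneous solutions of homogeneous monomial systems over $FA$ in $n$ unknowns is Noetherian: if $S_0\supseteq S_1\supseteq S_2\supseteq\cdots$ is a descending sequence of subsets of $FA^n$, each of which is the set of homogeneous solutions of some homogeneous monomial system over $FA$ in $x_1,\dots,x_n$, then there is an $N$ with $S_m=S_N$ for all $m\ge N$. -/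

import Mathlib

namespace MonomialEquations

/-- The free associative (unital) algebra `FA = GF₂⟨a₁, …, a_k⟩` over the field with two elements. -/
abbrev FA (k : ℕ) : Type := FreeAlgebra (ZMod 2) (Fin k)

/-- The monomial `a_{i₁} ⋯ a_{i_d}` of `FA` given by the word `w = i₁ ⋯ i_d`. -/
noncomputable def monomial {k : ℕ} (w : FreeMonoid (Fin k)) : FA k :=
  FreeMonoid.lift (FreeAlgebra.ι (ZMod 2)) w

/-- The homogeneous component of degree `d` of `FA`: the linear span of the monomials of
length `d`. -/
noncomputable def homogeneousPart (k d : ℕ) : Submodule (ZMod 2) (FA k) :=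
  Submodule.span (ZMod 2) {m | ∃ w : FreeMonoid (Fin k), w.length = d ∧ monomial w = m}

/-- An element of `FA` is homogeneous if it lies in `homogeneousPart k d` for some `d`
(in particular, `0` is homogeneous). -/
def IsHomogeneous {k : ℕ} (a : FA k) : Prop :=
  SetLike.IsHomogeneousElem (homogeneousPart k) a

/-- A monomial system of equations `u_i = v_i` (`i < numEqs`) over `FA` in `n` unknowns: each side
is a word in the free semigroup on (symbols for) the finitely many coefficients and the unknowns.
The coefficients are arbitrary elements of `FA`. -/
structure MonomialSystem (k n : ℕ) where
  /-- the number of coefficients -/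
  numCoeffs : ℕ
  /-- the coefficients -/
  coeff : Fin numCoeffs → FA k
  /-- the number of equations -/
  numEqs : ℕ
  /-- the left-hand sides -/
  lhs : Fin numEqs → FreeSemigroup (Fin numCoeffs ⊕ Fin n)
  /-- the right-hand sides -/
  rhs : Fin numEqs → FreeSemigroup (Fin numCoeffs ⊕ Fin n)

namespace MonomialSystem

variable {k n : ℕ}

/-- A monomial system is homogeneous if all its coefficients are homogeneous elements of `FA`. -/
def Homogeneous (Φ : MonomialSystem k n) : Prop :=
  ∀ j, IsHomogeneous (Φ.coeff j)

/-- The value in `FA` of a word in the coefficients and the unknowns, under the assignment `x`. -/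
noncomputable def evalWord (Φ : MonomialSystem k n) (x : Fin n → FA k) :
    FreeSemigroup (Fin Φ.numCoeffs ⊕ Fin n) →ₙ* FA k :=
  FreeSemigroup.lift (Sum.elim Φ.coeff x)

/-- The assignment `x` satisfies all equations of the system. -/
def IsSolution (Φ : MonomialSystem k n) (x : Fin n → FA k) : Prop :=
  ∀ i, Φ.evalWord x (Φ.lhs i) = Φ.evalWord x (Φ.rhs i)

/-- The set of homogeneous solutions: the solutions all of whose entries are homogeneous
(possibly of different degrees). -/
def homogeneousSolutions (Φ : MonomialSystem k n) : Set (Fin n → FA k) :=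
  {x | (∀ j, IsHomogeneous (x j)) ∧ Φ.IsSolution x}

end MonomialSystem

/-- The collection of the sets of homogeneous solutions of homogeneous monomial systems over `FA`
in `n` unknowns. -/
def homogeneousSolutionSets (k n : ℕ) : Set (Set (Fin n → FA k)) :=
  {S | ∃ Φ : MonomialSystem k n, Φ.Homogeneous ∧ Φ.homogeneousSolutions = S}

end MonomialEquations

/-!
Levi's lemma applies to the nonzero homogeneous elements of a free algebra over `𝔽₂`: comparing
coefficients at words `u * v * w` with fixed lengths shows that `a * b = c * d` with `deg a ≤ deg c`
forces `c = a * e`, and the only element of degree `0` is `1`. They therefore form a free monoid. A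
free monoid with zero embeds into the `2 × 2` matrices over a polynomial ring `K[X]`, by sending
each generator to the affine map `t ↦ X * t + c` with its own `c ≠ 0`. Through this embedding
equations between words become polynomial equations in the matrix entries, and Hilbert's basis
theorem reduces every system to a finite one.
-/

namespace MonomialEquations

open Function

section Equations

variable {M N σ : Type*}

/-- An equation `u = v` between words in the elements of `M`, serving as coefficients, and the
unknowns `σ`, encoded as the pair `(u, v)`. -/
abbrev Equation (M σ : Type*) : Type _ :=
  FreeSemigroup (M ⊕ σ) × FreeSemigroup (M ⊕ σ)

/-- The value in `M` of a word in the elements of `M` and the unknowns `σ`, when `x` is substituted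
for the unknowns. -/
def wordValue [Semigroup M] (x : σ → M) : FreeSemigroup (M ⊕ σ) →ₙ* M :=
  FreeSemigroup.lift (Sum.elim id x)

/-- The algebraic set defined by a (possibly infinite) system of equations over `M`. -/
def algebraicSet [Semigroup M] (E : Set (Equation M σ)) : Set (σ → M) :=
  {x | ∀ e ∈ E, wordValue x e.1 = wordValue x e.2}

/-- `M` is equationally Noetherian in the unknowns `σ`: every system of equations is equivalent to
a finite subsystem. -/
def EquationallyNoetherian (M σ : Type*) [Semigroup M] : Prop :=
  ∀ E : Set (Equation M σ), ∃ E₀ ⊆ E, E₀.Finite ∧ algebraicSet E₀ = algebraicSet E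

theorem algebraicSet_anti [Semigroup M] {E F : Set (Equation M σ)} (h : E ⊆ F) :
    algebraicSet F ⊆ algebraicSet E :=
  fun _ hx e he => hx e (h he)

theorem EquationallyNoetherian.exists_forall_ge_eq [Semigroup M]
    (hM : EquationallyNoetherian M σ) {E : ℕ → Set (Equation M σ)}
    (hanti : Antitone fun i => algebraicSet (E i)) :
    ∃ N, ∀ m, N ≤ m → algebraicSet (E m) = algebraicSet (E N) := by
  obtain ⟨E₀, hE₀, hfin, heq⟩ := hM (⋃ i, E i)
  have hidx : ∀ e ∈ E₀, ∃ i, e ∈ E i := fun e he => Set.mem_iUnion.1 (hE₀ he)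
  choose! idx hidx using hidx
  obtain ⟨N, hN⟩ := (hfin.image idx).bddAbove
  have hEN : algebraicSet (E N) ⊆ algebraicSet E₀ := fun x hx e he =>
    hanti (hN (Set.mem_image_of_mem idx he)) hx e (hidx e he)
  refine ⟨N, fun m hm => (hanti hm).antisymm ?_⟩
  calc algebraicSet (E N) ⊆ algebraicSet (⋃ i, E i) := heq ▸ hEN
    _ ⊆ algebraicSet (E m) := algebraicSet_anti (Set.subset_iUnion E m)

/-- The image of an equation under a change of coefficients. -/
def Equation.map (f : M → N) (e : Equation M σ) : Equation N σ :=
  (FreeSemigroup.map (Sum.map f id) e.1, FreeSemigroup.map (Sum.map f id) e.2)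

theorem wordValue_map [Semigroup M] [Semigroup N] (f : M →ₙ* N) (x : σ → M)
    (w : FreeSemigroup (M ⊕ σ)) :
    wordValue (f ∘ x) (FreeSemigroup.map (Sum.map f id) w) = f (wordValue x w) := by
  suffices h : (wordValue (f ∘ x)).comp (FreeSemigroup.map (Sum.map f id)) =
      f.comp (wordValue x) from DFunLike.congr_fun h w
  refine FreeSemigroup.hom_ext (funext fun s => ?_)
  cases s <;> rfl

theorem comp_mem_algebraicSet_image_map [Semigroup M] [Semigroup N] {f : M →ₙ* N}
    (hf : Injective f) {E : Set (Equation M σ)} {x : σ → M} :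
    f ∘ x ∈ algebraicSet (Equation.map f '' E) ↔ x ∈ algebraicSet E := by
  simp only [algebraicSet, Equation.map, Set.mem_ofPred_eq, Set.forall_mem_image, wordValue_map,
    hf.eq_iff]

theorem EquationallyNoetherian.of_injective [Semigroup M] [Semigroup N]
    (hN : EquationallyNoetherian N σ) (f : M →ₙ* N) (hf : Injective f) :
    EquationallyNoetherian M σ := by
  intro E
  obtain ⟨E₀, hE₀, hfin, heq⟩ := Set.exists_subset_image_finite_and.1 (hN (Equation.map f '' E))
  refine ⟨E₀, hE₀, hfin, Set.ext fun x => ?_⟩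
  rw [← comp_mem_algebraicSet_image_map hf, heq, comp_mem_algebraicSet_image_map hf]

end Equations

section Matrix

variable {ι σ R : Type*}

section CommSemiring

variable [CommSemiring R]

/-- The value of a word over a matrix semigroup when the unknowns are replaced by matrices of
indeterminates; the indeterminate `(j, r, s)` is the `(r, s)` entry of the unknown `j`. -/
noncomputable def genericValue [Fintype ι] :
    FreeSemigroup (Matrix ι ι R ⊕ σ) →ₙ* Matrix ι ι (MvPolynomial (σ × ι × ι) R) :=
  FreeSemigroup.lift (Sum.elim (fun A => A.map MvPolynomial.C)
    fun j => Matrix.of fun r s => MvPolynomial.X (j, r, s))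

/-- Evaluation of polynomials at the entries of the matrices `x j`. -/
noncomputable def entryEval (x : σ → Matrix ι ι R) : MvPolynomial (σ × ι × ι) R →+* R :=
  MvPolynomial.eval fun q => x q.1 q.2.1 q.2.2

theorem genericValue_map_entryEval [Fintype ι] (x : σ → Matrix ι ι R)
    (w : FreeSemigroup (Matrix ι ι R ⊕ σ)) :
    (genericValue w).map (entryEval x) = wordValue x w := by
  induction w using FreeSemigroup.recOnMul with
  | ih1 s => cases s <;> ext r s <;> simp [genericValue, wordValue, entryEval]
  | ih2 s w hs hw => rw [map_mul, map_mul, ← hs, ← hw, Matrix.map_mul]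

end CommSemiring

variable [Fintype ι] [CommRing R]

/-- The ideal generated by the entries of the difference of the two sides of a matrix equation. -/
noncomputable def equationIdeal (e : Equation (Matrix ι ι R) σ) :
    Ideal (MvPolynomial (σ × ι × ι) R) :=
  Ideal.span (Set.range fun p : ι × ι => (genericValue e.1 - genericValue e.2) p.1 p.2)

theorem equationIdeal_le_ker_entryEval {e : Equation (Matrix ι ι R) σ} {x : σ → Matrix ι ι R} :
    equationIdeal e ≤ RingHom.ker (entryEval x) ↔ wordValue x e.1 = wordValue x e.2 := by
  rw [equationIdeal, Ideal.span_le, Set.range_subset_iff, Prod.forall,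
    ← genericValue_map_entryEval, ← genericValue_map_entryEval, ← Matrix.ext_iff]
  simp only [SetLike.mem_coe, RingHom.mem_ker, Matrix.sub_apply, map_sub, sub_eq_zero,
    Matrix.map_apply]

theorem mem_algebraicSet_iff_sSup_equationIdeal_le {E : Set (Equation (Matrix ι ι R) σ)}
    {x : σ → Matrix ι ι R} :
    x ∈ algebraicSet E ↔ sSup (equationIdeal '' E) ≤ RingHom.ker (entryEval x) := by
  simp only [sSup_le_iff, Set.forall_mem_image, equationIdeal_le_ker_entryEval]
  rfl

theorem equationallyNoetherian_matrix [IsNoetherianRing R] [Finite σ] :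
    EquationallyNoetherian (Matrix ι ι R) σ := by
  intro E
  obtain ⟨I, hI, hsup⟩ := CompleteLattice.WellFoundedGT.isSupFiniteCompact
    (Ideal (MvPolynomial (σ × ι × ι) R)) (equationIdeal '' E)
  have hfinite : ∃ t ⊆ equationIdeal '' E, t.Finite ∧ sSup t = sSup (equationIdeal '' E) :=
    ⟨I, hI, I.finite_toSet, by rw [hsup, Finset.sup_id_eq_sSup]⟩
  obtain ⟨E₀, hE₀, hfin, heq⟩ := Set.exists_subset_image_finite_and.1 hfinite
  refine ⟨E₀, hE₀, hfin, Set.ext fun x => ?_⟩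
  rw [mem_algebraicSet_iff_sSup_equationIdeal_le, mem_algebraicSet_iff_sSup_equationIdeal_le, heq]

end Matrix

theorem withZero_lift'_injective {M N : Type*} [MulOneClass M] [MulZeroOneClass N] {f : M →* N}
    (hf : Injective f) (hf0 : ∀ a, f a ≠ 0) : Injective (WithZero.lift' f) := by
  rintro (_ | a) (_ | b) h
  · rfl
  · exact absurd h.symm (hf0 b)
  · exact absurd h (hf0 a)
  · exact congrArg _ (hf h)

section FreeMonoid

open Polynomial

variable {α R : Type*} [Semiring R]

/-- The matrix of the affine map `t ↦ X * t + c` over `R[X]`. -/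
noncomputable def affineMatrix (c : R) : Matrix (Fin 2) (Fin 2) R[X] :=
  !![X, C c; 0, 1]

/-- The polynomial whose coefficients, from degree `0` on, are the entries of a list. -/
noncomputable def listPolynomial : List R → R[X]
  | [] => 0
  | c :: l => X * listPolynomial l + C c

theorem X_mul_add_C_inj {p q : R[X]} {a b : R} :
    X * p + C a = X * q + C b ↔ p = q ∧ a = b := by
  refine ⟨fun h => ⟨?_, ?_⟩, by rintro ⟨rfl, rfl⟩; rfl⟩
  · ext n
    simpa using congrArg (coeff · (n + 1)) h
  · simpa using congrArg (coeff · 0) h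

theorem listPolynomial_cons_ne_zero {c : R} (hc : c ≠ 0) (l : List R) :
    listPolynomial (c :: l) ≠ 0 := fun h => hc <| by
  simpa [listPolynomial] using congrArg (coeff · 0) h

theorem listPolynomial_map_injective {φ : α → R} (hφ : Injective φ) (hφ0 : ∀ i, φ i ≠ 0) :
    Injective fun l : List α => listPolynomial (l.map φ) := by
  intro l
  induction l with
  | nil =>
    rintro (_ | ⟨i, l'⟩) h
    · rfl
    · exact absurd h.symm (listPolynomial_cons_ne_zero (hφ0 i) _)
  | cons i l ih =>
    rintro (_ | ⟨j, l'⟩) h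
    · exact absurd h (listPolynomial_cons_ne_zero (hφ0 i) _)
    · obtain ⟨hl, hij⟩ := X_mul_add_C_inj.1 h
      rw [hφ hij, ih hl]

theorem lift_affineMatrix_apply (φ : α → R) (w : FreeMonoid α) :
    FreeMonoid.lift (affineMatrix ∘ φ) w 0 1 = listPolynomial (w.toList.map φ) ∧
      FreeMonoid.lift (affineMatrix ∘ φ) w 1 1 = 1 := by
  induction w using FreeMonoid.recOn with
  | one => simp [listPolynomial]
  | of_mul i w ih =>
    rw [map_mul, FreeMonoid.lift_eval_of, FreeMonoid.toList_of_mul]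
    simp only [Matrix.mul_apply, Fin.sum_univ_two, ih.1, ih.2]
    simp [affineMatrix, listPolynomial]

theorem lift_affineMatrix_ne_zero [Nontrivial R] (φ : α → R) (w : FreeMonoid α) :
    FreeMonoid.lift (affineMatrix ∘ φ) w ≠ 0 := fun h => by
  simpa [h] using (lift_affineMatrix_apply φ w).2

theorem lift_affineMatrix_injective {φ : α → R} (hφ : Injective φ) (hφ0 : ∀ i, φ i ≠ 0) :
    Injective (FreeMonoid.lift (affineMatrix ∘ φ)) := by
  intro u v h
  have h01 := congrFun (congrFun h 0) 1
  rw [(lift_affineMatrix_apply φ u).1, (lift_affineMatrix_apply φ v).1] at h01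
  exact FreeMonoid.toList.injective (listPolynomial_map_injective hφ hφ0 h01)

theorem equationallyNoetherian_withZero_freeMonoid (α σ : Type*) [Finite σ] :
    EquationallyNoetherian (WithZero (FreeMonoid α)) σ := by
  let φ : α → FractionRing (MvPolynomial α ℤ) := fun i => algebraMap (MvPolynomial α ℤ) _ (.X i)
  have hφ : Injective φ := (IsFractionRing.injective _ _).comp MvPolynomial.X_injective
  have hφ0 : ∀ i, φ i ≠ 0 := fun i => by simp [φ]
  exact (equationallyNoetherian_matrix (ι := Fin 2)).of_injective
    (WithZero.lift' (FreeMonoid.lift (affineMatrix ∘ φ))).toMonoidHom.toMulHom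
    (withZero_lift'_injective (lift_affineMatrix_injective hφ hφ0) (lift_affineMatrix_ne_zero φ))

end FreeMonoid

section Levi

variable {M : Type*} [Monoid M]

/-- Levi's condition: any two factorizations of an element into two factors have a common
refinement. -/
def Equidivisible (M : Type*) [Mul M] : Prop :=
  ∀ ⦃a b c d : M⦄, a * b = c * d → (∃ e, c = a * e ∧ b = e * d) ∨ ∃ e, a = c * e ∧ d = e * b

variable {deg : M →* Multiplicative ℕ}

theorem eq_one_of_isUnit_of_deg (hdeg : ∀ a, deg a = 1 → a = 1) {a : M} (ha : IsUnit a) : a = 1 :=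
  hdeg a (ha.map deg).eq_one

theorem lift_irreducible_surjective (hdeg : ∀ a, deg a = 1 → a = 1) :
    Surjective (FreeMonoid.lift (Subtype.val : {p : M // Irreducible p} → M)) := by
  intro a
  induction h : (deg a).toAdd using Nat.strong_induction_on generalizing a with
  | _ d ih =>
    by_cases h1 : a = 1
    · exact ⟨1, by rw [map_one, h1]⟩
    by_cases hirr : Irreducible a
    · exact ⟨FreeMonoid.of ⟨a, hirr⟩, FreeMonoid.lift_eval_of _ _⟩
    obtain ⟨b, c, rfl, hb, hc⟩ : ∃ b c, a = b * c ∧ ¬IsUnit b ∧ ¬IsUnit c := by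
      simpa [irreducible_iff, mt (eq_one_of_isUnit_of_deg hdeg) h1] using hirr
    have hpos : ∀ x, ¬IsUnit x → 0 < (deg x).toAdd := fun x hx =>
      Nat.pos_of_ne_zero fun h0 => hx (hdeg x h0 ▸ isUnit_one)
    rw [map_mul, toAdd_mul] at h
    obtain ⟨u, rfl⟩ := ih _ (by have := hpos c hc; omega) b rfl
    obtain ⟨v, rfl⟩ := ih _ (by have := hpos _ hb; omega) c rfl
    exact ⟨u * v, map_mul _ u v⟩

theorem Equidivisible.eq_of_irreducible_mul_eq (hM : Equidivisible M)
    (hunit : ∀ a : M, IsUnit a → a = 1) {p q x y : M} (hp : Irreducible p) (hq : Irreducible q)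
    (h : p * x = q * y) : p = q ∧ x = y := by
  rcases hM h with ⟨e, rfl, rfl⟩ | ⟨e, rfl, rfl⟩
  · simp [hunit e ((hq.isUnit_or_isUnit rfl).resolve_left hp.not_isUnit)]
  · simp [hunit e ((hp.isUnit_or_isUnit rfl).resolve_left hq.not_isUnit)]

theorem Equidivisible.lift_irreducible_injective (hM : Equidivisible M)
    (hdeg : ∀ a, deg a = 1 → a = 1) :
    Injective (FreeMonoid.lift (Subtype.val : {p : M // Irreducible p} → M)) := by
  have hne : ∀ (p : {p : M // Irreducible p}) (x : M), (p : M) * x ≠ 1 := fun p x h =>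
    p.2.not_isUnit <| by
      have hdp : deg p * deg x = 1 := by rw [← map_mul, h, map_one]
      exact hdeg p (mul_eq_one.1 hdp).1 ▸ isUnit_one
  intro u
  induction u using FreeMonoid.recOn with
  | one =>
    intro v h
    cases v using FreeMonoid.casesOn with
    | one => rfl
    | of_mul q v =>
      rw [map_one, map_mul, FreeMonoid.lift_eval_of] at h
      exact absurd h.symm (hne _ _)
  | of_mul p u ih =>
    intro v h
    cases v using FreeMonoid.casesOn with
    | one =>
      rw [map_one, map_mul, FreeMonoid.lift_eval_of] at h
      exact absurd h (hne _ _)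
    | of_mul q v =>
      rw [map_mul, map_mul, FreeMonoid.lift_eval_of, FreeMonoid.lift_eval_of] at h
      obtain ⟨hpq, huv⟩ := hM.eq_of_irreducible_mul_eq
        (fun _ => eq_one_of_isUnit_of_deg hdeg) p.2 q.2 h
      rw [Subtype.ext hpq, ih huv]

/-- Levi's lemma: an equidivisible monoid with a grading whose degree-zero part is trivial is
free on its irreducible elements. -/
noncomputable def Equidivisible.freeMonoidEquiv (hM : Equidivisible M)
    (hdeg : ∀ a, deg a = 1 → a = 1) : FreeMonoid {p : M // Irreducible p} ≃* M :=
  MulEquiv.ofBijective (FreeMonoid.lift Subtype.val)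
    ⟨hM.lift_irreducible_injective hdeg, lift_irreducible_surjective hdeg⟩

end Levi

section Homogeneous

variable {R X : Type*}

section Semiring

variable [Semiring R] {a b : MonoidAlgebra R (FreeMonoid X)} {p q : ℕ}

/-- An element of the free algebra `R⟨X⟩`, realized as the monoid algebra of the free monoid, is
homogeneous of degree `p` if only words of length `p` occur in it. -/
def IsWordHomogeneous (a : MonoidAlgebra R (FreeMonoid X)) (p : ℕ) : Prop :=
  ∀ w, a.coeff w ≠ 0 → w.length = p

theorem isWordHomogeneous_zero (p : ℕ) : IsWordHomogeneous (0 : MonoidAlgebra R (FreeMonoid X)) p :=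
  fun _ hw => absurd rfl hw

theorem isWordHomogeneous_one : IsWordHomogeneous (1 : MonoidAlgebra R (FreeMonoid X)) 0 := by
  intro w hw
  rw [MonoidAlgebra.one_def, MonoidAlgebra.coeff_single, Finsupp.single_apply_ne_zero] at hw
  rw [hw.1, FreeMonoid.length_one]

theorem IsWordHomogeneous.mul (ha : IsWordHomogeneous a p) (hb : IsWordHomogeneous b q) :
    IsWordHomogeneous (a * b) (p + q) := by
  classical
  intro w hw
  obtain ⟨u, hu, v, hv, rfl⟩ := Finset.mem_mul.1
    (MonoidAlgebra.support_coeff_mul_subset a b (Finsupp.mem_support_iff.2 hw))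
  rw [FreeMonoid.length_mul, ha u (Finsupp.mem_support_iff.1 hu),
    hb v (Finsupp.mem_support_iff.1 hv)]

theorem IsWordHomogeneous.eq_of_ne_zero (hp : IsWordHomogeneous a p) (hq : IsWordHomogeneous a q)
    (ha : a ≠ 0) : p = q := by
  obtain ⟨w, hw⟩ := DFunLike.ne_iff.1 (mt MonoidAlgebra.coeff_eq_zero.1 ha)
  exact (hp w hw).symm.trans (hq w hw)

theorem IsWordHomogeneous.coeff_mul_mul (ha : IsWordHomogeneous a p) {u : FreeMonoid X}
    (hu : u.length = p) (b : MonoidAlgebra R (FreeMonoid X)) (v : FreeMonoid X) :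
    (a * b).coeff (u * v) = a.coeff u * b.coeff v := by
  refine MonoidAlgebra.coeff_mul_mul_of_uniqueMul fun u' v' hu' _ h => ?_
  exact List.append_inj h ((ha u' (Finsupp.mem_support_iff.1 hu')).trans hu.symm)

theorem IsWordHomogeneous.ext_mul (ha : IsWordHomogeneous a (p + q))
    (hb : IsWordHomogeneous b (p + q))
    (h : ∀ u v : FreeMonoid X, u.length = p → v.length = q → a.coeff (u * v) = b.coeff (u * v)) :
    a = b := by
  refine MonoidAlgebra.ext (Finsupp.ext fun w => ?_)
  by_cases hw : w.length = p + q
  · obtain ⟨u, v, hu, hv, rfl⟩ : ∃ u v : FreeMonoid X, u.length = p ∧ v.length = q ∧ u * v = w :=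
      ⟨.ofList (w.toList.take p), .ofList (w.toList.drop p),
        List.length_take_of_le (Nat.le_of_add_right_le hw.ge),
        List.length_drop.trans (Nat.sub_eq_of_eq_add' hw), List.take_append_drop p w.toList⟩
    exact h u v hu hv
  · rw [not_imp_comm.1 (ha w) hw, not_imp_comm.1 (hb w) hw]

variable (R X)

/-- The multiplicative monoid of all homogeneous elements of `R⟨X⟩`, including `0`. -/
def homogeneousElements : Submonoid (MonoidAlgebra R (FreeMonoid X)) where
  carrier := {a | ∃ p, IsWordHomogeneous a p}
  one_mem' := ⟨0, isWordHomogeneous_one⟩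
  mul_mem' := fun ⟨p, ha⟩ ⟨q, hb⟩ => ⟨p + q, ha.mul hb⟩

variable [Nontrivial R] [NoZeroDivisors R]

/-- The multiplicative monoid of the nonzero homogeneous elements of `R⟨X⟩`. -/
def nonzeroHomogeneousElements : Submonoid (MonoidAlgebra R (FreeMonoid X)) where
  carrier := {a | a ≠ 0 ∧ ∃ p, IsWordHomogeneous a p}
  one_mem' := ⟨one_ne_zero, (homogeneousElements R X).one_mem⟩
  mul_mem' := fun ha hb => ⟨mul_ne_zero ha.1 hb.1, (homogeneousElements R X).mul_mem ha.2 hb.2⟩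

/-- The degree of a nonzero homogeneous element. -/
noncomputable def homogeneousDegree : nonzeroHomogeneousElements R X →* Multiplicative ℕ where
  toFun a := .ofAdd a.2.2.choose
  map_one' := (Exists.choose_spec (1 : nonzeroHomogeneousElements R X).2.2).eq_of_ne_zero
    isWordHomogeneous_one one_ne_zero
  map_mul' a b := (a * b).2.2.choose_spec.eq_of_ne_zero
    (a.2.2.choose_spec.mul b.2.2.choose_spec) (a * b).2.1

variable {R X} in
theorem isWordHomogeneous_homogeneousDegree (a : nonzeroHomogeneousElements R X) :
    IsWordHomogeneous a.1 (homogeneousDegree R X a).toAdd :=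
  a.2.2.choose_spec

/-- The homogeneous elements are the nonzero ones with a zero adjoined. -/
noncomputable def withZeroNonzeroHomogeneousEquiv :
    WithZero (nonzeroHomogeneousElements R X) ≃* homogeneousElements R X :=
  MulEquiv.ofBijective
    ((WithZero.lift' (nonzeroHomogeneousElements R X).subtype).toMonoidHom.codRestrict
      (homogeneousElements R X) (by
        rintro (_ | a)
        · exact ⟨0, isWordHomogeneous_zero 0⟩
        · exact a.2.2))
    ⟨fun a b h => withZero_lift'_injective Subtype.val_injective (fun a => a.2.1)
        (congrArg Subtype.val h),
      fun a => by
        by_cases ha : (a : MonoidAlgebra R (FreeMonoid X)) = 0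
        · exact ⟨0, Subtype.ext ha.symm⟩
        · exact ⟨((⟨a, ha, a.2⟩ : nonzeroHomogeneousElements R X) : WithZero _), rfl⟩⟩

end Semiring

section DivisionRing

variable [DivisionRing R] {a b c d : MonoidAlgebra R (FreeMonoid X)} {p q r : ℕ}

theorem exists_isWordHomogeneous_eq_mul (ha : IsWordHomogeneous a p)
    (hb : IsWordHomogeneous b (q + r)) (hc : IsWordHomogeneous c (p + q))
    (hd : IsWordHomogeneous d r) (hd0 : d ≠ 0) (h : a * b = c * d) :
    ∃ e, IsWordHomogeneous e q ∧ c = a * e := by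
  obtain ⟨w, hw⟩ := DFunLike.ne_iff.1 (mt MonoidAlgebra.coeff_eq_zero.1 hd0)
  -- Strip the suffix `w` from the words of `b` and divide by the coefficient of `w` in `d`.
  let e : MonoidAlgebra R (FreeMonoid X) :=
    .ofCoeff ((b.coeff.comapDomain (· * w) (mul_left_injective w).injOn).mapRange
      (· * (d.coeff w)⁻¹) (zero_mul _))
  have he : ∀ v, e.coeff v = b.coeff (v * w) * (d.coeff w)⁻¹ := fun v => rfl
  have heq : IsWordHomogeneous e q := fun v hv => by
    have hvw := hb _ (left_ne_zero_of_mul (he v ▸ hv))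
    rwa [FreeMonoid.length_mul, hd w hw, Nat.add_right_cancel_iff] at hvw
  refine ⟨e, heq, hc.ext_mul (ha.mul heq) fun u v hu hv => ?_⟩
  have huvw : a.coeff u * b.coeff (v * w) = c.coeff (u * v) * d.coeff w := by
    rw [← ha.coeff_mul_mul hu, h, ← mul_assoc,
      hc.coeff_mul_mul (by rw [FreeMonoid.length_mul, hu, hv])]
  rw [ha.coeff_mul_mul hu, he, ← mul_assoc, huvw, mul_inv_cancel_right₀ hw]

theorem exists_nonzeroHomogeneousElements_eq_mul {a b c d : nonzeroHomogeneousElements R X}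
    (ha : IsWordHomogeneous a.1 p) (hc : IsWordHomogeneous c.1 (p + q)) (h : a * b = c * d) :
    ∃ e, c = a * e ∧ b = e * d := by
  obtain ⟨-, s, hb⟩ := b.2
  obtain ⟨hd0, r, hd⟩ := d.2
  have hval : a.1 * b.1 = c.1 * d.1 := congrArg Subtype.val h
  have hs : p + s = p + q + r := (ha.mul hb).eq_of_ne_zero (hval ▸ hc.mul hd) (a * b).2.1
  obtain rfl : s = q + r := by omega
  obtain ⟨e, he, hce⟩ := exists_isWordHomogeneous_eq_mul ha hb hc hd hd0 hval
  have he0 : e ≠ 0 := by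
    rintro rfl
    exact c.2.1 (hce.trans (mul_zero _))
  have hbe : b.1 = e * d.1 := mul_left_cancel₀ a.2.1 (by rw [hval, hce, mul_assoc])
  exact ⟨⟨e, he0, q, he⟩, Subtype.ext hce, Subtype.ext hbe⟩

theorem equidivisible_nonzeroHomogeneousElements :
    Equidivisible (nonzeroHomogeneousElements R X) := by
  intro a b c d h
  obtain ⟨-, p, ha⟩ := a.2
  obtain ⟨-, q, hc⟩ := c.2
  rcases le_total p q with hpq | hqp
  · obtain ⟨t, rfl⟩ := Nat.exists_eq_add_of_le hpq
    exact .inl (exists_nonzeroHomogeneousElements_eq_mul ha hc h)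
  · obtain ⟨t, rfl⟩ := Nat.exists_eq_add_of_le hqp
    exact .inr (exists_nonzeroHomogeneousElements_eq_mul hc ha h.symm)

end DivisionRing

theorem IsWordHomogeneous.eq_one_of_degree_zero {a : MonoidAlgebra (ZMod 2) (FreeMonoid X)}
    (ha : IsWordHomogeneous a 0) (ha0 : a ≠ 0) : a = 1 := by
  refine ha.ext_mul (p := 0) (q := 0) isWordHomogeneous_one fun u v hu hv => ?_
  obtain ⟨w, hw⟩ := DFunLike.ne_iff.1 (mt MonoidAlgebra.coeff_eq_zero.1 ha0)
  rw [FreeMonoid.length_eq_zero.1 (ha w hw)] at hw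
  rw [FreeMonoid.length_eq_zero.1 hu, FreeMonoid.length_eq_zero.1 hv, mul_one,
    MonoidAlgebra.coeff_one_one]
  exact Fin.eq_one_of_ne_zero _ hw

end Homogeneous

section FreeAlgebra

open FreeAlgebra (equivMonoidAlgebraFreeMonoid)

variable {k n : ℕ}

theorem basisFreeMonoid_eq_monomial :
    FreeAlgebra.basisFreeMonoid (ZMod 2) (Fin k) = (monomial : FreeMonoid (Fin k) → FA k) :=
  funext fun w => MonoidAlgebra.lift_of (FreeMonoid.lift (FreeAlgebra.ι (ZMod 2))) w

theorem mem_homogeneousPart_iff {d : ℕ} {a : FA k} :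
    a ∈ homogeneousPart k d ↔
      IsWordHomogeneous (equivMonoidAlgebraFreeMonoid a) d := by
  change a ∈ Submodule.span (ZMod 2) (monomial '' {w | w.length = d}) ↔ _
  rw [← basisFreeMonoid_eq_monomial, Module.Basis.mem_span_image]
  exact forall_congr' fun w => imp_congr Finsupp.mem_support_iff Iff.rfl

variable (k) in
/-- The inclusion into `FA k` of its homogeneous elements, which are viewed in the monoid algebra of
the free monoid. -/
noncomputable def homogeneousInclusion : homogeneousElements (ZMod 2) (Fin k) →ₙ* FA k :=
  (equivMonoidAlgebraFreeMonoid.symm : _ ≃ₐ[ZMod 2] FA k).toMulEquiv.toMulHom.comp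
    (homogeneousElements (ZMod 2) (Fin k)).subtype.toMulHom

theorem homogeneousInclusion_injective : Injective (homogeneousInclusion k) :=
  equivMonoidAlgebraFreeMonoid.symm.injective.comp Subtype.val_injective

theorem isHomogeneous_iff_exists_homogeneousInclusion_eq {a : FA k} :
    IsHomogeneous a ↔ ∃ b, homogeneousInclusion k b = a := by
  constructor
  · rintro ⟨d, hd⟩
    exact ⟨⟨_, d, mem_homogeneousPart_iff.1 hd⟩, equivMonoidAlgebraFreeMonoid.symm_apply_apply a⟩
  · rintro ⟨⟨b, d, hb⟩, rfl⟩
    refine ⟨d, mem_homogeneousPart_iff.2 ?_⟩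
    exact (equivMonoidAlgebraFreeMonoid.apply_symm_apply b).symm ▸ hb

theorem evalWord_homogeneousInclusion {Φ : MonomialSystem k n}
    {c : Fin Φ.numCoeffs → homogeneousElements (ZMod 2) (Fin k)}
    (hc : ∀ i, homogeneousInclusion k (c i) = Φ.coeff i)
    (y : Fin n → homogeneousElements (ZMod 2) (Fin k))
    (w : FreeSemigroup (Fin Φ.numCoeffs ⊕ Fin n)) :
    Φ.evalWord (homogeneousInclusion k ∘ y) w =
      homogeneousInclusion k (wordValue y (FreeSemigroup.map (Sum.map c id) w)) := by
  suffices h : Φ.evalWord (homogeneousInclusion k ∘ y) =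
      (homogeneousInclusion k).comp ((wordValue y).comp (FreeSemigroup.map (Sum.map c id))) from
    DFunLike.congr_fun h w
  refine FreeSemigroup.hom_ext (funext fun s => ?_)
  cases s with
  | inl i => exact (hc i).symm
  | inr j => rfl

theorem exists_image_algebraicSet_eq {S : Set (Fin n → FA k)}
    (hS : S ∈ homogeneousSolutionSets k n) :
    ∃ E : Set (Equation (homogeneousElements (ZMod 2) (Fin k)) (Fin n)),
      (homogeneousInclusion k ∘ ·) '' algebraicSet E = S := by
  obtain ⟨Φ, hΦ, rfl⟩ := hS
  choose c hc using fun i => isHomogeneous_iff_exists_homogeneousInclusion_eq.1 (hΦ i)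
  let toEquation (i : Fin Φ.numEqs) : Equation (homogeneousElements (ZMod 2) (Fin k)) (Fin n) :=
    (FreeSemigroup.map (Sum.map c id) (Φ.lhs i), FreeSemigroup.map (Sum.map c id) (Φ.rhs i))
  have hsol : ∀ y, y ∈ algebraicSet (Set.range toEquation) ↔
      Φ.IsSolution (homogeneousInclusion k ∘ y) := fun y => by
    simp only [algebraicSet, Set.mem_ofPred_eq, Set.forall_mem_range, MonomialSystem.IsSolution,
      evalWord_homogeneousInclusion hc, homogeneousInclusion_injective.eq_iff, toEquation]
  refine ⟨Set.range toEquation, Set.ext fun x => ⟨?_, ?_⟩⟩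
  · rintro ⟨y, hy, rfl⟩
    exact ⟨fun j => isHomogeneous_iff_exists_homogeneousInclusion_eq.2 ⟨y j, rfl⟩, (hsol y).1 hy⟩
  · rintro ⟨hx, hΦx⟩
    choose y hy using fun j => isHomogeneous_iff_exists_homogeneousInclusion_eq.1 (hx j)
    obtain rfl : homogeneousInclusion k ∘ y = x := funext hy
    exact ⟨y, (hsol y).2 hΦx, rfl⟩

theorem EquationallyNoetherian.exists_forall_ge_eq_of_mem_homogeneousSolutionSets
    (hNoeth : EquationallyNoetherian (homogeneousElements (ZMod 2) (Fin k)) (Fin n))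
    {S : ℕ → Set (Fin n → FA k)} (hS : ∀ i, S i ∈ homogeneousSolutionSets k n)
    (hdesc : ∀ i, S (i + 1) ⊆ S i) : ∃ N, ∀ m, N ≤ m → S m = S N := by
  choose E hE using fun i => exists_image_algebraicSet_eq (hS i)
  have hanti : Antitone fun i => algebraicSet (E i) := antitone_nat_of_succ_le fun i => by
    rw [← Set.image_subset_image_iff homogeneousInclusion_injective.comp_left, hE, hE]
    exact hdesc i
  obtain ⟨N, hN⟩ := hNoeth.exists_forall_ge_eq hanti
  exact ⟨N, fun m hm => by rw [← hE, ← hE, hN m hm]⟩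

end FreeAlgebra

end MonomialEquations

open MonomialEquations in
theorem corollary1p2_general (X σ : Type*) [Finite σ] :
    EquationallyNoetherian (homogeneousElements (ZMod 2) X) σ := by
  have hdeg : ∀ a, homogeneousDegree (ZMod 2) X a = 1 → a = 1 := fun a h =>
    Subtype.ext <| IsWordHomogeneous.eq_one_of_degree_zero
      (by simpa only [h, toAdd_one] using isWordHomogeneous_homogeneousDegree a) a.2.1
  let f := equidivisible_nonzeroHomogeneousElements.freeMonoidEquiv hdeg
  have hN : EquationallyNoetherian (WithZero (nonzeroHomogeneousElements (ZMod 2) X)) σ :=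
    (equationallyNoetherian_withZero_freeMonoid _ σ).of_injective
      (WithZero.map' f.symm.toMonoidHom).toMonoidHom.toMulHom
      (WithZero.map'_injective f.symm.injective)
  exact hN.of_injective (withZeroNonzeroHomogeneousEquiv (ZMod 2) X).symm.toMulHom
    (MulEquiv.injective _)

theorem corollary1p2 (k n : ℕ) (S : ℕ → Set (Fin n → MonomialEquations.FA k))
    (hS : ∀ i, S i ∈ MonomialEquations.homogeneousSolutionSets k n)
    (hdesc : ∀ i, S (i + 1) ⊆ S i) :
    ∃ N, ∀ m, N ≤ m → S m = S N :=
  (corollary1p2_general (Fin k) (Fin n)).exists_forall_ge_eq_of_mem_homogeneousSolutionSets hS hdesc
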